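/- Let $\Delta\subset\mathbb{R}^2$ be the Sierpiński triangle, constructed from a closed equilateral triangle of side length $1$ and equipped with the Euclidean metric; let $\lambda$ be Lebesgue measure on $\mathbb{R}$, and let $0<\alpha\le 1$. Let $C_1^{\alpha}(\Delta)$ be the space, with the topology of the supremum norm, of all 1-Hölder-$\alpha$ functions on $\Delta$, i.e. of all $f:\Delta\to\mathbb{R}$ with $|f(a)-f(b)|\le |a-b|^{\alpha}$ for all $a,b\in\Delta$. For $f:\Delta\to\mathbb{R}$ put $D_*^f(\Delta)=\sup\{d\ge 0:\lambda\{r:\dim_H f^{-1}(r)\ge d\}>0\}$, where $\dim_H\emptyset=0$, and let $$D_*(\alpha,\Delta)=\sup_{\mathcal G}\ \inf_{f\in\mathcal G} D_*^f(\Delta),$$ where $\mathcal G$ runs over all dense $G_\delta$ subsets of $C_1^{\alpha}(\Delta)$. Let $$h(d)=\frac{-d\log d-(1-d)\log(1-d)+d\log 6}{(1+d)\log 2},\qquad d\in(0,\tfrac12].$$ **Theorem.** The function $h$ is injective on $(0,\tfrac12]$ and takes the value $\alpha$ there, so that $h^{-1}(\alpha)\in(0,\tfrac12]$ is well defined. For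 every 1-Hölder-$\alpha$ function $f:\Delta\to\mathbb{R}$ and for Lebesgue almost every $r\in f(\Delta)$, $$\dim_H f^{-1}(r)\ \ge\ \frac{h^{-1}(\alpha)}{1+h^{-1}(\alpha)}.$$ Moreover, $D_*(\alpha,\Delta)\ge h^{-1}(\alpha)$. -/

import Mathlib

open MeasureTheory Set

noncomputable section

namespace HolderLevelSets

/-! ### Hölder functions and the generic dimension of their level sets -/

/-- `f` is `c`-Hölder-`α`: `|f a - f b| ≤ c * d(a, b) ^ α` for all `a`, `b`. -/
def IsHolder {M : Type*} [MetricSpace M] (c α : ℝ) (f : M → ℝ) : Prop :=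
  ∀ a b : M, |f a - f b| ≤ c * dist a b ^ α

/-- The space `C_c^α(M)` of continuous `c`-Hölder-`α` functions on `M`, as a subset of `C(M, ℝ)`.
The topology of `C(M, ℝ)` is the compact-open one; for compact `M` this is the topology of the
supremum norm. -/
def holderSpace (c α : ℝ) (M : Type*) [MetricSpace M] : Set C(M, ℝ) :=
  {f | IsHolder c α f}

/-- `D^f(r, F)`, the Hausdorff dimension of the level set of `f : F → ℝ` at level `r`. -/
def levelDim {M : Type*} [MetricSpace M] (f : M → ℝ) (r : ℝ) : ENNReal :=
  dimH (f ⁻¹' {r})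

/-- `D_*^f(F)`, the supremum of the `d` such that the level sets of dimension at least `d` belong to
a set of levels of positive Lebesgue measure. -/
def DStarFun {M : Type*} [MetricSpace M] (f : M → ℝ) : ENNReal :=
  sSup {d : ENNReal | 0 < volume {r : ℝ | d ≤ levelDim f r}}

/-- `D_*(α, F)`, the supremum over all dense `G_δ` subsets `G` of `C_1^α(F)` of the infimum of
`D_*^f(F)` over `f ∈ G`. -/
def DStar {p : ℕ} (α : ℝ) (F : Set (EuclideanSpace ℝ (Fin p))) : ENNReal :=
  ⨆ (G : Set (holderSpace 1 α F)) (_ : Dense G) (_ : IsGδ G), ⨅ f ∈ G, DStarFun (f : C(F, ℝ))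

/-! ### The Sierpiński triangle -/

/-- The vertices of an equilateral triangle of side length one. -/
def corner : Fin 3 → EuclideanSpace ℝ (Fin 2) :=
  ![!₂[0, 0], !₂[1, 0], !₂[1 / 2, √3 / 2]]

/-- `Δ_n`, the union of the triangles of side length `2⁻ⁿ` at the `n`th step of the construction:
`Δ_0` is the full triangle and `Δ_{n+1}` consists of the three copies of `Δ_n` scaled by one half
towards the corners. -/
def sierpinskiStage : ℕ → Set (EuclideanSpace ℝ (Fin 2))
  | 0 => convexHull ℝ (range corner)
  | n + 1 => ⋃ i : Fin 3, AffineMap.homothety (corner i) (1 / 2 : ℝ) '' sierpinskiStage n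

/-- The Sierpiński triangle `Δ = ⋂ₙ Δ_n`. -/
def sierpinski : Set (EuclideanSpace ℝ (Fin 2)) :=
  ⋂ n : ℕ, sierpinskiStage n

/-! ### The function in the bound -/

/-- `h(d) = (-d log d - (1 - d) log (1 - d) + d log 6) / ((1 + d) log 2)`; it is only used on its
domain `(0, 1/2]`. -/
def h (d : ℝ) : ℝ :=
  (-d * Real.log d - (1 - d) * Real.log (1 - d) + d * Real.log 6) / ((1 + d) * Real.log 2)

/-- The inverse of `h` on `(0, 1/2]`. Its value at `α` is the preimage of `α` in that interval
whenever there is exactly one. -/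
def hInv (α : ℝ) : ℝ :=
  Function.invFunOn h (Ioc 0 (1 / 2)) α

end HolderLevelSets

end

namespace HolderLevelSets

open Filter Topology
open scoped ENNReal

/-! ### Infinite paths in the ternary tree -/

/-! Fix a level `r` that is not a vertex value. A triangle cut by `r` has one vertex alone on its
side of `r`, and some child of it is cut again. Spread a unit mass from the root, evenly among the
cut children (`mass`). Paths of positive mass converge to points of the level set, so a mass
distribution principle (`hausdorffMeasure_ne_zero_of_mass`) bounds its dimension below by `δ` once
the triangles of side `ℓ` and mass above `ℓ ^ δ` have finite total mass.

For almost every `r` this follows from a moment estimate (`IsVertexTree.ae_tsum_large_mass_ne_top`).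
By `IsVertexTree.cut_children` the mass at least halves in each step, unless the only cut child sits
at the lone vertex and keeps it as lone vertex. A lone vertex has a strictly extremal value, and a
triangle has at most two such vertices. Hence the powers `mass ^ (1 + q)` are dominated by
quantities `weight` that do not depend on `r` and whose sum grows by a factor of at most `1 + 6 * 2
^ (-(1 + q))` per generation. By the Hölder condition the levels cutting a triangle of generation
`n` fill a length of order `2 ^ (-α * n)`. The integral over `r` therefore converges if `(1 + 6 * 2
^ (-(1 + q))) * 2 ^ (-α) * 2 ^ (δ * q) < 1`, and the best `q` (`exists_exponent`) allows every `δ <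
d`, where `h d = α`.

Contractions carry the result from the root to all triangles. Almost every level in the range thus
has dimension at least `d`, which is more than `d / (1 + d)`. The bound on `DStar` follows because
the nonconstant functions form a dense open set. -/

/-- The words of length `n`. -/
def words : ℕ → Finset (List (Fin 3))
  | 0 => {[]}
  | n + 1 => (words n ×ˢ Finset.univ).image fun p => p.2 :: p.1

lemma mem_words {n : ℕ} {w : List (Fin 3)} : w ∈ words n ↔ w.length = n := by
  induction n generalizing w with
  | zero => simp [words]
  | succ n ih =>
    cases w with
    | nil => simp [words]
    | cons j w => simp [words, ih]

lemma sum_words_succ {M : Type*} [AddCommMonoid M] (n : ℕ) (F : List (Fin 3) → M) :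
    ∑ w ∈ words (n + 1), F w = ∑ w ∈ words n, ∑ j, F (j :: w) := by
  rw [words, Finset.sum_image, Finset.sum_product]
  rintro ⟨a, b⟩ - ⟨c, d⟩ - h
  simp only [List.cons.injEq] at h
  exact Prod.ext h.2 h.1

lemma tsum_le_tsum_words (F : List (Fin 3) → ℝ≥0∞) :
    ∑' w, F w ≤ ∑' n, ∑ w ∈ words n, F w := by
  calc ∑' w, F w ≤ ∑' w, ∑' n, (if w ∈ words n then F w else 0) := by
        refine ENNReal.tsum_le_tsum fun w => ?_
        refine le_trans ?_ (ENNReal.le_tsum w.length)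
        simp [mem_words]
    _ = ∑' n, ∑' w, (if w ∈ words n then F w else 0) := ENNReal.tsum_comm
    _ = ∑' n, ∑ w ∈ words n, F w := by
        refine tsum_congr fun n => ?_
        rw [tsum_eq_sum (s := words n) (fun w hw => by simp [hw])]
        exact Finset.sum_congr rfl fun w hw => by simp [hw]

/-- The initial word of length `n` of an infinite path, with the latest letter first. -/
def initialWord (x : ℕ → Fin 3) : ℕ → List (Fin 3)
  | 0 => []
  | n + 1 => x n :: initialWord x n

lemma length_initialWord (x : ℕ → Fin 3) (n : ℕ) : (initialWord x n).length = n := by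
  induction n with
  | zero => rfl
  | succ n ih => simp [initialWord, ih]

/-- Latest letters come first, so the descendants of a word are the lists having it as a suffix;
distinct children have disjoint sets of descendants. -/
lemma sum_indicator_suffix_le (w u : List (Fin 3)) (S : Set (List (Fin 3)))
    (μ : List (Fin 3) → ℝ≥0∞) :
    ∑ j, (S ∩ {u | (j :: w) <:+ u}).indicator μ u ≤ (S ∩ {u | w <:+ u}).indicator μ u := by
  by_cases h : ∃ j, u ∈ S ∩ {u | (j :: w) <:+ u}
  · obtain ⟨j, hS, hj⟩ := h
    rw [Finset.sum_eq_single j]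
    · rw [indicator_of_mem (show u ∈ S ∩ {u | (j :: w) <:+ u} from ⟨hS, hj⟩),
        indicator_of_mem]
      exact ⟨hS, (List.suffix_cons j w).trans hj⟩
    · intro k _ hk
      refine indicator_of_notMem (fun hm => hk ?_) _
      obtain ⟨a, ha⟩ := hm.2
      obtain ⟨b, hb⟩ := hj
      have := List.append_inj' (ha.trans hb.symm) (by simp)
      simpa using this.2
    · simp
  · push Not at h
    rw [Finset.sum_eq_zero fun j _ => indicator_of_notMem (h j) _]
    exact zero_le

/-- If the total mass of a set of words is less than one, some infinite path of positive masses
avoids that set. -/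
lemma exists_path_avoiding {μ : List (Fin 3) → ℝ≥0∞} (hμ : ∀ w, μ w = ∑ j, μ (j :: w))
    {S : Set (List (Fin 3))} (hS : ∑' w, S.indicator μ w < μ []) :
    ∃ x : ℕ → Fin 3, ∀ n, initialWord x n ∉ S ∧ μ (initialWord x n) ≠ 0 := by
  -- The part of `S` below `w` weighs less than `w`. Some child inherits this, since otherwise
  -- summing over the children contradicts it for `w`.
  let good : List (Fin 3) → Prop := fun w =>
    ∑' u, (S ∩ {u | w <:+ u}).indicator μ u < μ w
  have step : ∀ w, good w → ∃ j, good (j :: w) := by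
    intro w hw
    by_contra! hc
    refine absurd hw (not_lt.2 ?_)
    calc μ w = ∑ j, μ (j :: w) := hμ w
      _ ≤ ∑ j, ∑' u, (S ∩ {u | (j :: w) <:+ u}).indicator μ u :=
          Finset.sum_le_sum fun j _ => not_lt.1 (hc j)
      _ = ∑' u, ∑ j, (S ∩ {u | (j :: w) <:+ u}).indicator μ u :=
          (Summable.tsum_finsetSum fun _ _ => ENNReal.summable).symm
      _ ≤ _ := ENNReal.tsum_le_tsum fun u => sum_indicator_suffix_le w u S μ
  have h0 : good [] := by
    refine lt_of_le_of_lt (ENNReal.tsum_le_tsum fun u => ?_) hS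
    exact indicator_le_indicator_of_subset inter_subset_left (fun _ => zero_le) u
  choose! next hnext using step
  let W : ℕ → List (Fin 3) := fun n => Nat.rec [] (fun _ w => next w :: w) n
  have hW : ∀ n, initialWord (fun k => next (W k)) n = W n := by
    intro n
    induction n with
    | zero => rfl
    | succ n ih => simp only [initialWord, ih, W]
  have hgood : ∀ n, good (W n) := by
    intro n
    induction n with
    | zero => exact h0
    | succ n ih => exact hnext _ ih
  refine ⟨fun k => next (W k), fun n => ?_⟩
  rw [hW]
  refine ⟨fun hm => ?_, (lt_of_le_of_lt zero_le (hgood n)).ne'⟩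
  -- If `W n` were in `S`, its own term would already exhaust its mass.
  refine absurd (hgood n) (not_lt.2 ?_)
  refine le_trans (le_of_eq ?_) (ENNReal.le_tsum (W n))
  rw [indicator_of_mem]
  exact ⟨hm, List.suffix_refl _⟩

/-! ### Vertex values and the triangles cut by a level -/

/-- Some value of `v` lies below `r` and some value lies above. -/
def IsCut (v : Fin 3 → ℝ) (r : ℝ) : Prop := ∃ i j, v i < r ∧ r < v j

/-- The value of `v` at `i` lies on one side of `r`, the two others on the other side. -/
def IsLone (v : Fin 3 → ℝ) (r : ℝ) (i : Fin 3) : Prop :=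
  (v i < r ∧ ∀ j ≠ i, r < v j) ∨ (r < v i ∧ ∀ j ≠ i, v j < r)

/-- The value of `v` at `i` is the strict minimum or the strict maximum. -/
def IsExtremal (v : Fin 3 → ℝ) (i : Fin 3) : Prop :=
  (∀ j ≠ i, v i < v j) ∨ (∀ j ≠ i, v j < v i)

lemma IsLone.isExtremal {v : Fin 3 → ℝ} {r : ℝ} {i : Fin 3} (h : IsLone v r i) :
    IsExtremal v i :=
  h.imp (fun h j hj => h.1.trans (h.2 j hj)) (fun h j hj => (h.2 j hj).trans h.1)

-- Strictness matters: a middle value is not extremal, and tied vertices are not either.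
open Classical in
lemma card_isExtremal_le (v : Fin 3 → ℝ) :
    (Finset.univ.filter fun i => IsExtremal v i).card ≤ 2 := by
  by_contra! h
  have huniv : (Finset.univ.filter fun i => IsExtremal v i) = Finset.univ :=
    Finset.eq_univ_of_card _ (le_antisymm (Finset.card_le_univ _) (by simpa using Nat.succ_le_of_lt h))
  have hall : ∀ i, IsExtremal v i := fun i => by
    have := Finset.mem_univ i
    rw [← huniv] at this
    exact (Finset.mem_filter.1 this).2
  have h0 := hall 0
  have h1 := hall 1
  have h2 := hall 2
  simp [IsExtremal, Fin.forall_fin_succ] at h0 h1 h2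
  grind

lemma exists_isLone {v : Fin 3 → ℝ} {r : ℝ} (hr : ∀ i, v i ≠ r) (h : IsCut v r) :
    ∃ i, IsLone v r i := by
  obtain ⟨i, j, hi, hj⟩ := h
  have h0 := hr 0
  have h1 := hr 1
  have h2 := hr 2
  simp [IsLone, Fin.forall_fin_succ, Fin.exists_fin_succ]
  fin_cases i <;> fin_cases j <;> simp at hi hj <;> grind

/-- The values at the vertices of a tree of triangles: the child `j` of a triangle has in common
the vertex `j` with the triangle and the vertex with label `i` with its sibling `i`. -/
structure IsVertexTree (g : List (Fin 3) → Fin 3 → ℝ) : Prop where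
  self : ∀ w j, g (j :: w) j = g w j
  symm : ∀ w i j, g (j :: w) i = g (i :: w) j

section Tree

variable {g : List (Fin 3) → Fin 3 → ℝ} {r : ℝ}

lemma isCut_iff_sign {v : Fin 3 → ℝ} (hr : ∀ i, v i ≠ r) :
    IsCut v r ↔ ∃ i j, decide (v i < r) = true ∧ decide (v j < r) = false := by
  simp only [IsCut, decide_eq_true_eq, decide_eq_false_iff_not, not_lt]
  exact exists₂_congr fun i j => and_congr_right fun _ =>
    ⟨fun h => h.le, fun h => lt_of_le_of_ne h (hr j).symm⟩

lemma isLone_iff_sign {v : Fin 3 → ℝ} (hr : ∀ i, v i ≠ r) (i : Fin 3) :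
    IsLone v r i ↔ ∀ j ≠ i, decide (v j < r) = !decide (v i < r) := by
  have h0 := hr 0
  have h1 := hr 1
  have h2 := hr 2
  simp only [IsLone]
  rcases lt_or_gt_of_ne (hr i) with h | h
  · simp only [h, not_lt_of_gt h, true_and, false_and, or_false, decide_true, Bool.not_true,
      decide_eq_false_iff_not, not_lt]
    exact forall₂_congr fun j _ => ⟨fun h => h.le, fun h => lt_of_le_of_ne h (hr j).symm⟩
  · simp [h, not_lt_of_gt h]

/-- Only the sides of `r` on which the three corners (`s`) and the three edge midpoints (`m01`,
`m02`, `m12`) lie matter, so 64 patterns are checked. Row `k` of `c` lists the vertices of child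
`k`. -/
lemma sign_dichotomy : ∀ s : Fin 3 → Bool, ∀ m01 m02 m12 : Bool,
    let c : Fin 3 → Fin 3 → Bool := ![![s 0, m01, m02], ![m01, s 1, m12], ![m02, m12, s 2]]
    (∃ i j, s i = true ∧ s j = false) →
    (∃ i, (∀ j ≠ i, s j = !s i) ∧ ∀ k, (∃ a b, c k a = true ∧ c k b = false) → k = i ∧
      ∀ a, (∀ b ≠ a, c k b = !c k a) → a = i) ∧ (∃ k, ∃ a b, c k a = true ∧ c k b = false) ∨
    ∃ k l, k ≠ l ∧ (∃ a b, c k a = true ∧ c k b = false) ∧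
      ∃ a b, c l a = true ∧ c l b = false := by
  decide

/-- A cut triangle has two cut children, or its only cut child is the one at the lone vertex, and
there this vertex is still the lone one. -/
lemma IsVertexTree.cut_children (hg : IsVertexTree g) {w : List (Fin 3)}
    (hr : ∀ w i, g w i ≠ r) (hw : IsCut (g w) r) :
    (∃ i, IsLone (g w) r i ∧ ∀ k, IsCut (g (k :: w)) r → k = i ∧
      ∀ a, IsLone (g (k :: w)) r a → a = i) ∧ (∃ k, IsCut (g (k :: w)) r) ∨
    ∃ k l, k ≠ l ∧ IsCut (g (k :: w)) r ∧ IsCut (g (l :: w)) r := by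
  have key := sign_dichotomy (fun i => decide (g w i < r)) (decide (g (0 :: w) 1 < r))
    (decide (g (0 :: w) 2 < r)) (decide (g (1 :: w) 2 < r))
  have hc : (![![decide (g w 0 < r), decide (g (0 :: w) 1 < r), decide (g (0 :: w) 2 < r)],
      ![decide (g (0 :: w) 1 < r), decide (g w 1 < r), decide (g (1 :: w) 2 < r)],
      ![decide (g (0 :: w) 2 < r), decide (g (1 :: w) 2 < r), decide (g w 2 < r)]] :
      Fin 3 → Fin 3 → Bool) = fun k i => decide (g (k :: w) i < r) := by
    funext k i
    fin_cases k <;> fin_cases i <;>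
      simp [hg.self, hg.symm w 0 1, hg.symm w 0 2, hg.symm w 1 2]
  simp only [hc] at key
  simp only [isCut_iff_sign (hr _), isLone_iff_sign (hr _)] at hw ⊢
  exact key hw

/-! ### The mass on cut triangles and its moments -/

open Classical in
/-- The unit mass at the root, distributed evenly among the cut children of each triangle. -/
noncomputable def mass (g : List (Fin 3) → Fin 3 → ℝ) (r : ℝ) : List (Fin 3) → ℝ≥0∞
  | [] => 1
  | j :: w => if IsCut (g (j :: w)) r then
      mass g r w / (Finset.univ.filter fun k => IsCut (g (k :: w)) r).card else 0

lemma isCut_of_mass_ne_zero (h0 : IsCut (g []) r) {w : List (Fin 3)} (hw : mass g r w ≠ 0) :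
    IsCut (g w) r := by
  cases w with
  | nil => exact h0
  | cons j w =>
    by_contra h
    simp [mass, h] at hw

lemma IsVertexTree.exists_cut_child (hg : IsVertexTree g) {w : List (Fin 3)}
    (hr : ∀ w i, g w i ≠ r) (hw : IsCut (g w) r) : ∃ k, IsCut (g (k :: w)) r := by
  rcases hg.cut_children hr hw with h | ⟨k, _, _, h, _⟩
  · exact h.2
  · exact ⟨k, h⟩

lemma IsVertexTree.mass_eq_sum (hg : IsVertexTree g) (hr : ∀ w i, g w i ≠ r)
    (h0 : IsCut (g []) r) (w : List (Fin 3)) : mass g r w = ∑ j, mass g r (j :: w) := by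
  classical
  simp only [mass]
  rw [← Finset.sum_filter, Finset.sum_const, nsmul_eq_mul]
  by_cases hw : mass g r w = 0
  · simp [hw]
  · obtain ⟨k, hk⟩ := hg.exists_cut_child hr (isCut_of_mass_ne_zero h0 hw)
    rw [ENNReal.mul_div_cancel _ (ENNReal.natCast_ne_top _)]
    exact_mod_cast Finset.card_ne_zero_of_mem (Finset.mem_filter.2 ⟨Finset.mem_univ k, hk⟩)

open Classical in
/-- An upper bound for a power of the mass of a triangle on the levels at which a given vertex is
the lone one. -/
noncomputable def weight (g : List (Fin 3) → Fin 3 → ℝ) (t : ℝ≥0∞) : List (Fin 3) → Fin 3 → ℝ≥0∞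
  | [], _ => 1
  | j :: w, i => if IsExtremal (g (j :: w)) i then
      (if i = j then weight g t w j else 0) + t * ∑ k, weight g t w k else 0

/-- The inherited terms add up to at most the old total; three children with at most two extremal
vertices each give the `6 * t`. -/
lemma sum_weight_cons_le (g : List (Fin 3) → Fin 3 → ℝ) (t : ℝ≥0∞) (w : List (Fin 3)) :
    ∑ j, ∑ i, weight g t (j :: w) i ≤ (1 + 6 * t) * ∑ i, weight g t w i := by
  classical
  have h (j : Fin 3) : ∑ i, weight g t (j :: w) i ≤
      weight g t w j + 2 * (t * ∑ k, weight g t w k) := by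
    simp only [weight]
    rw [← Finset.sum_filter, Finset.sum_add_distrib, Finset.sum_const, nsmul_eq_mul]
    gcongr
    · refine (Finset.sum_le_sum_of_subset (Finset.subset_univ _)).trans ?_
      simp
    · exact_mod_cast card_isExtremal_le _
  refine (Finset.sum_le_sum fun j _ => h j).trans (le_of_eq ?_)
  rw [Finset.sum_add_distrib, Finset.sum_const]
  simp only [Finset.card_univ, Fintype.card_fin, nsmul_eq_mul]
  push_cast
  ring

lemma sum_words_weight_le (g : List (Fin 3) → Fin 3 → ℝ) (t : ℝ≥0∞) (n : ℕ) :
    ∑ w ∈ words n, ∑ i, weight g t w i ≤ 3 * (1 + 6 * t) ^ n := by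
  induction n with
  | zero => simp [words, weight]
  | succ n ih =>
    rw [sum_words_succ]
    refine (Finset.sum_le_sum fun w _ => sum_weight_cons_le g t w).trans ?_
    rw [← Finset.mul_sum]
    calc _ ≤ (1 + 6 * t) * (3 * (1 + 6 * t) ^ n) := by gcongr
      _ = _ := by ring

/-- The two terms of `weight` match the two cases of `cut_children`: an undivided mass passes along
the same lone label, whereas a mass that at least halves may come from any lone label of the parent,
whence the sum over `k`. -/
lemma IsVertexTree.mass_rpow_le_weight (hg : IsVertexTree g) (hr : ∀ w i, g w i ≠ r)
    (h0 : IsCut (g []) r) {s : ℝ} (hs : 0 < s) {w : List (Fin 3)} {i : Fin 3}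
    (hi : IsLone (g w) r i) : mass g r w ^ s ≤ weight g (2⁻¹ ^ s) w i := by
  classical
  induction w generalizing i with
  | nil => simp [mass, weight]
  | cons j w ih =>
    by_cases hj : mass g r (j :: w) = 0
    · simp [hj, ENNReal.zero_rpow_of_pos hs]
    have hcut := isCut_of_mass_ne_zero h0 hj
    have hw : mass g r w ≠ 0 := fun h => hj (by simp [mass, h])
    simp only [weight, if_pos hi.isExtremal]
    simp only [mass, if_pos hcut]
    rcases hg.cut_children hr (isCut_of_mass_ne_zero h0 hw) with ⟨⟨k, hk, hk'⟩, -⟩ | ⟨k, l, hkl, hk, hl⟩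
    · obtain ⟨rfl, h2⟩ := hk' j hcut
      obtain rfl := h2 i hi
      have hcard : (Finset.univ.filter fun k => IsCut (g (k :: w)) r).card = 1 :=
        Finset.card_eq_one.2 ⟨i, Finset.ext fun k => by
          simpa using ⟨fun h => (hk' k h).1, fun h => h ▸ hcut⟩⟩
      simp only [hcard, Nat.cast_one, div_one, if_true]
      exact (ih hk).trans le_self_add
    · obtain ⟨a, ha⟩ := exists_isLone (hr w) (isCut_of_mass_ne_zero h0 hw)
      have hcard : 2 ≤ (Finset.univ.filter fun k => IsCut (g (k :: w)) r).card := by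
        rw [← Finset.card_pair hkl]
        exact Finset.card_le_card (by simp [Finset.insert_subset_iff, hk, hl])
      calc _ ≤ (mass g r w / 2) ^ s := by
            gcongr
            exact_mod_cast hcard
        _ = 2⁻¹ ^ s * mass g r w ^ s := by
            rw [div_eq_mul_inv, ENNReal.mul_rpow_of_nonneg _ _ hs.le, mul_comm]
        _ ≤ 2⁻¹ ^ s * ∑ k, weight g (2⁻¹ ^ s) w k := by
            gcongr
            exact (ih ha).trans (Finset.single_le_sum (f := fun k => weight g (2⁻¹ ^ s) w k)
              (fun _ _ => zero_le) (Finset.mem_univ a))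
        _ ≤ _ := le_add_self

lemma ae_forall_ne (g : List (Fin 3) → Fin 3 → ℝ) :
    ∀ᵐ r ∂(volume : Measure ℝ), ∀ w i, g w i ≠ r := by
  have : (⋃ w, ⋃ i, {g w i}).Countable :=
    countable_iUnion fun w => countable_iUnion fun i => countable_singleton _
  filter_upwards [this.ae_notMem volume] with r hr w i h
  exact hr (mem_iUnion₂.2 ⟨w, i, h.symm⟩)

lemma IsLone.mem_closedBall {v : Fin 3 → ℝ} {r ε : ℝ} {i : Fin 3} (h : IsLone v r i)
    (hv : ∀ i j, |v i - v j| ≤ ε) : r ∈ Metric.closedBall (v i) ε := by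
  obtain ⟨j, hj⟩ := exists_ne i
  have hij := abs_le.1 (hv i j)
  rw [Metric.mem_closedBall, Real.dist_eq, abs_le]
  rcases h with h | h
  · have := h.2 j hj
    constructor <;> linarith [h.1]
  · have := h.2 j hj
    constructor <;> linarith [h.1]

/-- Markov's trick: `(m / c) ^ q` is at least one. -/
lemma le_rpow_mul_of_lt {m c : ℝ≥0∞} {q : ℝ} (hq : 0 < q) (hc : c ≠ 0) (hc' : c ≠ ∞)
    (h : c < m) (hm : m ≠ ∞) : m ≤ (c⁻¹) ^ q * m ^ (1 + q) := by
  have hm0 : m ≠ 0 := (lt_of_le_of_lt zero_le h).ne'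
  have h1 : 1 ≤ (c⁻¹) ^ q * m ^ q := by
    rw [← ENNReal.mul_rpow_of_nonneg _ _ hq.le]
    refine ENNReal.one_le_rpow ?_ hq
    rw [← ENNReal.inv_mul_cancel hc hc']
    gcongr
  calc m = 1 * m := (one_mul m).symm
    _ ≤ ((c⁻¹) ^ q * m ^ q) * m := by gcongr
    _ = _ := by rw [ENNReal.rpow_add _ _ hm0 hm, ENNReal.rpow_one]; ring

lemma mass_le_one (g : List (Fin 3) → Fin 3 → ℝ) (r : ℝ) (w : List (Fin 3)) :
    mass g r w ≤ 1 := by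
  classical
  induction w with
  | nil => simp [mass]
  | cons j w ih =>
    simp only [mass]
    split_ifs with h
    · refine (ENNReal.div_le_of_le_mul ?_).trans ih
      refine le_mul_of_one_le_right zero_le ?_
      have : 0 < (Finset.univ.filter fun k => IsCut (g (k :: w)) r).card :=
        Finset.card_pos.2 ⟨j, by simpa using h⟩
      exact_mod_cast this
    · exact zero_le

/-- For almost every level, the triangles of too large mass have finite total mass. -/
theorem IsVertexTree.ae_tsum_large_mass_ne_top (hg : IsVertexTree g) {a : ℝ} (ha : 0 < a)
    (hga : ∀ w i j, |g w i - g w j| ≤ a ^ w.length) {b : ℝ≥0∞} (hb : b ≠ 0) (hb' : b ≠ ∞)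
    {q : ℝ} (hq : 0 < q)
    (h : (1 + 6 * 2⁻¹ ^ (1 + q)) * ENNReal.ofReal a * (b⁻¹) ^ q < 1) :
    ∀ᵐ r ∂(volume : Measure ℝ), IsCut (g []) r →
      ∑' w, {w | b ^ w.length < mass g r w}.indicator (mass g r) w ≠ ∞ := by
  set t : ℝ≥0∞ := 2⁻¹ ^ (1 + q) with ht
  -- `F w` dominates the large masses at `w`; its dependence on `r` is only through balls around the
  -- vertex values, so it is measurable and its integral is explicit.
  let F : List (Fin 3) → ℝ → ℝ≥0∞ := fun w r => ((b⁻¹) ^ q) ^ w.length *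
    ∑ i, weight g t w i * (Metric.closedBall (g w i) (a ^ w.length)).indicator 1 r
  have hmeas : ∀ w, Measurable (F w) := fun w => by
    refine Measurable.const_mul (Finset.measurable_sum _ fun i _ => ?_) _
    exact (measurable_one.indicator Metric.isClosed_closedBall.measurableSet).const_mul _
  have hint : ∀ w, ∫⁻ r, F w r = ((b⁻¹) ^ q) ^ w.length *
      (∑ i, weight g t w i) * (2 * ENNReal.ofReal a ^ w.length) := by
    intro w
    have hm : ∀ i : Fin 3, Measurable fun r : ℝ =>
        (Metric.closedBall (g w i) (a ^ w.length)).indicator (1 : ℝ → ℝ≥0∞) r := fun i =>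
      measurable_one.indicator Metric.isClosed_closedBall.measurableSet
    simp only [F]
    rw [lintegral_const_mul _ (Finset.measurable_sum _ fun i _ => (hm i).const_mul _),
      lintegral_finsetSum _ fun i _ => (hm i).const_mul _, mul_assoc, Finset.sum_mul]
    congr 1
    refine Finset.sum_congr rfl fun i _ => ?_
    rw [lintegral_const_mul _ (hm i), lintegral_indicator_one
      Metric.isClosed_closedBall.measurableSet, Real.volume_closedBall,
      ENNReal.ofReal_mul zero_le_two, ENNReal.ofReal_pow ha.le]
    simp
  have htotal : ∫⁻ r, ∑' w, F w r ≠ ∞ := by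
    rw [lintegral_tsum fun w => (hmeas w).aemeasurable]
    refine ne_top_of_le_ne_top ?_ (tsum_le_tsum_words _)
    set ρ := (1 + 6 * t) * ENNReal.ofReal a * (b⁻¹) ^ q
    have hle : ∀ n, ∑ w ∈ words n, ∫⁻ r, F w r ≤ 6 * ρ ^ n := by
      intro n
      calc ∑ w ∈ words n, ∫⁻ r, F w r
          = ((b⁻¹) ^ q) ^ n * (2 * ENNReal.ofReal a ^ n) *
            ∑ w ∈ words n, ∑ i, weight g t w i := by
            rw [Finset.mul_sum]
            refine Finset.sum_congr rfl fun w hw => ?_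
            rw [hint, mem_words.1 hw]
            ring
        _ ≤ ((b⁻¹) ^ q) ^ n * (2 * ENNReal.ofReal a ^ n) * (3 * (1 + 6 * t) ^ n) := by
            gcongr
            exact sum_words_weight_le g t n
        -- The constant is 2 from the length of a ball times 3 from the weights at the root.
        _ = 6 * ρ ^ n := by
            simp only [ρ, mul_pow]
            ring
    refine ne_top_of_le_ne_top ?_ (ENNReal.tsum_le_tsum hle)
    rw [ENNReal.tsum_mul_left, ENNReal.tsum_geometric]
    refine ENNReal.mul_ne_top (by simp) (ENNReal.inv_ne_top.2 ?_)
    exact (tsub_pos_of_lt h).ne'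
  have hfin := ae_lt_top (Measurable.tsum hmeas) htotal
  filter_upwards [hfin, ae_forall_ne g] with r hr hne h0
  refine ne_top_of_le_ne_top hr.ne (ENNReal.tsum_le_tsum fun w => ?_)
  by_cases hw : b ^ w.length < mass g r w
  · rw [indicator_of_mem (show w ∈ {w | b ^ w.length < mass g r w} from hw)]
    have hm0 : mass g r w ≠ 0 := (lt_of_le_of_lt zero_le hw).ne'
    obtain ⟨i, hi⟩ := exists_isLone (hne w) (isCut_of_mass_ne_zero h0 hm0)
    refine (le_rpow_mul_of_lt hq (pow_ne_zero _ hb) (ENNReal.pow_ne_top hb') hw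
      ((mass_le_one g r w).trans_lt ENNReal.one_lt_top).ne).trans ?_
    simp only [F]
    refine mul_le_mul' (le_of_eq ?_) ?_
    · rw [ENNReal.inv_pow, ← ENNReal.rpow_natCast, ← ENNReal.rpow_natCast, ← ENNReal.rpow_mul,
        ← ENNReal.rpow_mul, mul_comm]
    · refine (hg.mass_rpow_le_weight hne h0 (by linarith) hi).trans ?_
      refine le_trans (le_of_eq ?_) (Finset.single_le_sum (fun _ _ => zero_le)
        (Finset.mem_univ i))
      rw [indicator_of_mem (hi.mem_closedBall (hga w))]
      simp [ht]
  · rw [indicator_of_notMem (by simpa using hw)]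
    exact zero_le

end Tree

/-! ### The vertices of the Sierpiński triangle -/

/-- The vertices of the triangle with address `w`, read from the last letter to the first. -/
noncomputable def vertex : List (Fin 3) → Fin 3 → EuclideanSpace ℝ (Fin 2)
  | [] => corner
  | j :: w => fun i => (1 / 2 : ℝ) • (vertex w j + vertex w i)

lemma homothety_corner_apply (i : Fin 3) (x : EuclideanSpace ℝ (Fin 2)) :
    AffineMap.homothety (corner i) (1 / 2 : ℝ) x = (1 / 2 : ℝ) • (corner i + x) := by
  rw [AffineMap.homothety_apply, vsub_eq_sub, vadd_eq_add]
  module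

/-- The last list entry is the first choice made in the subdivision, so appending contracts the
whole picture, whereas prepending subdivides a triangle. -/
lemma vertex_append (w : List (Fin 3)) (i j : Fin 3) :
    vertex (w ++ [i]) j = AffineMap.homothety (corner i) (1 / 2 : ℝ) (vertex w j) := by
  induction w generalizing j with
  | nil => rw [homothety_corner_apply]; rfl
  | cons k w ih =>
    rw [List.cons_append]
    simp only [vertex, ih, homothety_corner_apply]
    module

lemma dist_homothety_corner (i : Fin 3) (x y : EuclideanSpace ℝ (Fin 2)) :
    dist (AffineMap.homothety (corner i) (1 / 2 : ℝ) x)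
      (AffineMap.homothety (corner i) (1 / 2 : ℝ) y) = 1 / 2 * dist x y := by
  rw [homothety_corner_apply, homothety_corner_apply, dist_smul₀, dist_add_left]
  norm_num

lemma dist_corner_le (i j : Fin 3) : dist (corner i) (corner j) ≤ 1 := by
  rw [EuclideanSpace.dist_eq, Real.sqrt_le_one]
  fin_cases i <;> fin_cases j <;>
    simp [corner, Fin.sum_univ_two, Real.dist_eq, div_pow] <;> norm_num

lemma dist_vertex_le (w : List (Fin 3)) (i j : Fin 3) :
    dist (vertex w i) (vertex w j) ≤ (1 / 2) ^ w.length := by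
  induction w generalizing i j with
  | nil => simpa [vertex] using dist_corner_le i j
  | cons k w ih =>
    simp only [vertex, List.length_cons]
    rw [dist_smul₀, dist_add_left, pow_succ, mul_comm]
    norm_num
    simpa using ih i j

lemma dist_vertex_cons_zero_le (w : List (Fin 3)) (j : Fin 3) :
    dist (vertex w 0) (vertex (j :: w) 0) ≤ (1 / 2) ^ (w.length + 1) := by
  have : vertex w 0 = (1 / 2 : ℝ) • (vertex w 0 + vertex w 0) := by module
  rw [this]
  simp only [vertex]
  rw [dist_smul₀, dist_add_right, pow_succ, mul_comm]
  norm_num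
  simpa using dist_vertex_le w 0 j

lemma vertex_mem_sierpinskiStage (n : ℕ) (w : List (Fin 3)) (j : Fin 3) :
    vertex w j ∈ sierpinskiStage n := by
  induction n generalizing w j with
  | zero =>
    induction w generalizing j with
    | nil => exact subset_convexHull _ _ (mem_range_self j)
    | cons k w ih =>
      have := (convex_convexHull ℝ (range corner)) (ih k) (ih j)
        (by norm_num : (0 : ℝ) ≤ 1 / 2) (by norm_num : (0 : ℝ) ≤ 1 / 2) (by norm_num)
      simpa only [sierpinskiStage, vertex, smul_add] using this
  | succ n ih =>
    rcases List.eq_nil_or_concat w with rfl | ⟨w, i, rfl⟩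
    · refine mem_iUnion.2 ⟨j, vertex [] j, ih _ _, ?_⟩
      exact AffineMap.homothety_apply_same _ _
    · rw [List.concat_eq_append, vertex_append]
      exact mem_iUnion.2 ⟨i, mem_image_of_mem _ (ih _ _)⟩

/-- The vertices as points of the Sierpiński triangle. -/
noncomputable def vertexPt (w : List (Fin 3)) (i : Fin 3) : sierpinski :=
  ⟨vertex w i, mem_iInter.2 fun n => vertex_mem_sierpinskiStage n w i⟩

lemma dist_vertexPt_le (w : List (Fin 3)) (i j : Fin 3) :
    dist (vertexPt w i) (vertexPt w j) ≤ (1 / 2) ^ w.length :=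
  dist_vertex_le w i j

lemma isVertexTree_vertexPt (f : sierpinski → ℝ) :
    IsVertexTree fun w i => f (vertexPt w i) where
  self w j := congrArg f (Subtype.ext (by simp only [vertexPt, vertex]; module))
  symm w i j := congrArg f (Subtype.ext (by simp only [vertexPt, vertex]; module))

lemma isCompact_sierpinskiStage (n : ℕ) : IsCompact (sierpinskiStage n) := by
  induction n with
  | zero => exact (finite_range corner).isCompact_convexHull (𝕜 := ℝ)
  | succ n ih =>
    refine isCompact_iUnion fun i => ih.image ?_
    exact AffineMap.continuous_of_finiteDimensional (AffineMap.homothety (corner i) (1 / 2 : ℝ))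

lemma isCompact_sierpinski : IsCompact sierpinski :=
  (isCompact_sierpinskiStage 0).of_isClosed_subset
    (isClosed_iInter fun n => (isCompact_sierpinskiStage n).isClosed) (iInter_subset _ 0)

instance : CompactSpace sierpinski := isCompact_iff_compactSpace.1 isCompact_sierpinski

lemma dist_corner_le_of_mem {x : EuclideanSpace ℝ (Fin 2)} (hx : x ∈ sierpinskiStage 0)
    (i : Fin 3) : dist x (corner i) ≤ 1 := by
  have : convexHull ℝ (range corner) ⊆ Metric.closedBall (corner i) 1 :=
    convexHull_min (range_subset_iff.2 fun j => dist_corner_le j i) (convex_closedBall _ _)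
  exact this hx

lemma exists_vertex_near (n : ℕ) {x : EuclideanSpace ℝ (Fin 2)} (hx : x ∈ sierpinskiStage n) :
    ∃ w, dist (vertex w 0) x ≤ (1 / 2) ^ n := by
  induction n generalizing x with
  | zero => exact ⟨[], by simpa [vertex, dist_comm] using dist_corner_le_of_mem hx 0⟩
  | succ n ih =>
    obtain ⟨i, y, hy, rfl⟩ := mem_iUnion.1 hx
    obtain ⟨w, hw⟩ := ih hy
    refine ⟨w ++ [i], ?_⟩
    rw [vertex_append, dist_homothety_corner, pow_succ]
    linarith

lemma exists_vertexPt_near (x : sierpinski) {ε : ℝ} (hε : 0 < ε) :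
    ∃ w, dist (vertexPt w 0) x < ε := by
  obtain ⟨n, hn⟩ := exists_pow_lt_of_lt_one hε (by norm_num : (1 / 2 : ℝ) < 1)
  obtain ⟨w, hw⟩ := exists_vertex_near n (mem_iInter.1 x.2 n)
  exact ⟨w, lt_of_le_of_lt hw hn⟩

lemma homothety_mem_sierpinski (i : Fin 3) {x : EuclideanSpace ℝ (Fin 2)}
    (hx : x ∈ sierpinski) : AffineMap.homothety (corner i) (1 / 2 : ℝ) x ∈ sierpinski := by
  refine mem_iInter.2 fun n => ?_
  cases n with
  | zero =>
    rw [homothety_corner_apply, smul_add]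
    exact (convex_convexHull ℝ (range corner)) (subset_convexHull _ _ (mem_range_self i))
      (mem_iInter.1 hx 0) (by norm_num) (by norm_num) (by norm_num)
  | succ n => exact mem_iUnion.2 ⟨i, mem_image_of_mem _ (mem_iInter.1 hx n)⟩

/-- The contraction of the Sierpiński triangle towards one of its corners. -/
noncomputable def contraction (i : Fin 3) (x : sierpinski) : sierpinski :=
  ⟨AffineMap.homothety (corner i) (1 / 2 : ℝ) x, homothety_mem_sierpinski i x.2⟩

lemma dist_contraction (i : Fin 3) (x y : sierpinski) :
    dist (contraction i x) (contraction i y) = 1 / 2 * dist x y :=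
  dist_homothety_corner i x y

lemma contraction_vertexPt (i : Fin 3) (w : List (Fin 3)) (j : Fin 3) :
    contraction i (vertexPt w j) = vertexPt (w ++ [i]) j :=
  Subtype.ext (vertex_append w i j).symm

/-! ### Counting triangles of a given size -/

/-- The lattice coordinates of the triangle with address `w`. -/
def latticeCoord : List (Fin 3) → ℤ × ℤ
  | [] => (0, 0)
  | j :: w => (2 * (latticeCoord w).1 + if j = 1 then 1 else 0,
      2 * (latticeCoord w).2 + if j = 2 then 1 else 0)

lemma vertex_eq_latticeCoord (w : List (Fin 3)) (i : Fin 3) :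
    vertex w i = ((1 / 2 : ℝ) ^ w.length) •
      (((latticeCoord w).1 : ℝ) • corner 1 + ((latticeCoord w).2 : ℝ) • corner 2 + corner i) := by
  induction w generalizing i with
  | nil => simp [vertex, latticeCoord]
  | cons j w ih =>
    have h0 : corner 0 = 0 := by ext k; fin_cases k <;> simp [corner]
    simp only [vertex, ih, latticeCoord, List.length_cons, pow_succ]
    fin_cases j <;> simp [h0] <;> module

/-- The parities of the two coordinates determine the latest letter. -/
lemma latticeCoord_injective {w u : List (Fin 3)} (hl : w.length = u.length)
    (h : latticeCoord w = latticeCoord u) : w = u := by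
  induction w generalizing u with
  | nil => exact (List.eq_nil_of_length_eq_zero hl.symm).symm
  | cons j w ih =>
    cases u with
    | nil => simp at hl
    | cons k u =>
      simp only [latticeCoord, Prod.mk.injEq] at h
      obtain ⟨h1, h2⟩ := h
      have hjk : j = k ∧ latticeCoord w = latticeCoord u := by
        rw [Prod.ext_iff]
        fin_cases j <;> fin_cases k <;> simp at h1 h2 ⊢ <;> omega
      rw [hjk.1, ih (by simpa using hl) hjk.2]

lemma abs_latticeCoord_sub_le {w u : List (Fin 3)} (hl : w.length = u.length)
    (h : dist (vertex w 0) (vertex u 0) ≤ 3 * (1 / 2) ^ w.length) :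
    |(latticeCoord w).1 - (latticeCoord u).1| ≤ 5 ∧
      |(latticeCoord w).2 - (latticeCoord u).2| ≤ 5 := by
  set a : ℤ := (latticeCoord w).1 - (latticeCoord u).1 with ha
  set b : ℤ := (latticeCoord w).2 - (latticeCoord u).2 with hb
  have hpos : (0 : ℝ) < (1 / 2) ^ w.length := by positivity
  have hnorm : ‖(a : ℝ) • corner 1 + (b : ℝ) • corner 2‖ ≤ 3 := by
    rw [vertex_eq_latticeCoord, vertex_eq_latticeCoord, ← hl, dist_smul₀, dist_eq_norm,
      Real.norm_of_nonneg hpos.le, mul_comm] at h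
    have := le_of_mul_le_mul_right h hpos
    refine le_trans (le_of_eq (congrArg norm ?_)) this
    rw [ha, hb]
    push_cast
    module
  have h0 := (PiLp.norm_apply_le ((a : ℝ) • corner 1 + (b : ℝ) • corner 2) 0).trans hnorm
  have h1 := (PiLp.norm_apply_le ((a : ℝ) • corner 1 + (b : ℝ) • corner 2) 1).trans hnorm
  simp [corner] at h0 h1
  have hs : (1.7 : ℝ) < √3 := Real.lt_sqrt_of_sq_lt (by norm_num)
  have hb' : |(b : ℝ)| < 4 := by
    by_contra! hc
    rw [abs_of_pos (by positivity : (0 : ℝ) < √3)] at h1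
    nlinarith
  have hb2 := abs_lt.1 hb'
  have h02 := abs_le.1 h0
  have ha' : |(a : ℝ)| < 6 := abs_lt.2 ⟨by linarith, by linarith⟩
  have ha3 : |a| < 6 := by exact_mod_cast ha'
  have hb3 : |b| < 4 := by exact_mod_cast hb'
  exact ⟨by omega, by omega⟩

-- Any two such triangles have reference vertices within `3 * 2 ^ (-n)`: two distances to points of
-- `U` plus the diameter of `U`. Their lattice coordinates then lie in an 11 by 11 box.
open Classical in
lemma card_words_near_le (n : ℕ) (U : Set sierpinski) (hU : Metric.ediam U ≤ 2⁻¹ ^ n) :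
    ((words n).filter fun w => ∃ y ∈ U, dist (vertexPt w 0) y ≤ (1 / 2) ^ n).card ≤ 121 := by
  set V := (words n).filter fun w => ∃ y ∈ U, dist (vertexPt w 0) y ≤ (1 / 2) ^ n with hV
  rcases V.eq_empty_or_nonempty with he | ⟨u, hu⟩
  · simp [he]
  have hn : ∀ y ∈ U, ∀ z ∈ U, dist y z ≤ (1 / 2) ^ n := by
    intro y hy z hz
    have := (Metric.edist_le_ediam_of_mem hy hz).trans hU
    rw [edist_dist, ← ENNReal.toReal_le_toReal ENNReal.ofReal_ne_top (by finiteness),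
      ENNReal.toReal_ofReal dist_nonneg] at this
    simpa using this
  have hnear : ∀ w ∈ V, w.length = n ∧ |(latticeCoord w).1 - (latticeCoord u).1| ≤ 5 ∧
      |(latticeCoord w).2 - (latticeCoord u).2| ≤ 5 := by
    intro w hw
    simp only [hV, Finset.mem_filter, mem_words] at hw hu
    obtain ⟨hwn, y, hy, hwy⟩ := hw
    obtain ⟨hun, z, hz, huz⟩ := hu
    refine ⟨hwn, abs_latticeCoord_sub_le (hwn.trans hun.symm) ?_⟩
    rw [hwn]
    have h1 : dist (vertexPt w 0) (vertexPt u 0) ≤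
        dist (vertexPt w 0) y + dist y z + dist z (vertexPt u 0) := dist_triangle4 _ _ _ _
    have h2 := hn y hy z hz
    rw [dist_comm] at huz
    change dist (vertexPt w 0) (vertexPt u 0) ≤ _
    linarith
  calc V.card ≤ (Finset.Icc ((latticeCoord u).1 - 5) ((latticeCoord u).1 + 5) ×ˢ
      Finset.Icc ((latticeCoord u).2 - 5) ((latticeCoord u).2 + 5)).card := by
        refine Finset.card_le_card_of_injOn latticeCoord (fun w hw => ?_) fun w hw v hv h => ?_
        · obtain ⟨-, h1, h2⟩ := hnear w hw
          rw [abs_le] at h1 h2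
          simp only [Finset.coe_product, Finset.coe_Icc, mem_prod, mem_Icc]
          omega
        · exact latticeCoord_injective ((hnear w hw).1.trans (hnear v hv).1.symm) h
    _ = 121 := by
        rw [Finset.card_product, Int.card_Icc, Int.card_Icc]
        have h1 : ((latticeCoord u).1 + 5 + 1 - ((latticeCoord u).1 - 5)).toNat = 11 := by omega
        have h2 : ((latticeCoord u).2 + 5 + 1 - ((latticeCoord u).2 - 5)).toNat = 11 := by omega
        rw [h1, h2]

/-! ### The mass distribution principle for a mass on the tree -/

/-- The triangles along an infinite path shrink to a point. -/
lemma exists_limit_point (x : ℕ → Fin 3) :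
    ∃ p : sierpinski, ∀ n, dist (vertexPt (initialWord x n) 0) p ≤ (1 / 2) ^ n := by
  have hstep : ∀ n, dist (vertexPt (initialWord x n) 0) (vertexPt (initialWord x (n + 1)) 0) ≤
      1 / 2 / 2 ^ n := by
    intro n
    refine (dist_vertex_cons_zero_le (initialWord x n) (x n)).trans (le_of_eq ?_)
    rw [length_initialWord, pow_succ, one_div_pow]
    ring
  obtain ⟨p, hp⟩ := cauchySeq_tendsto_of_complete (cauchySeq_of_le_geometric_two hstep)
  refine ⟨p, fun n => ?_⟩
  rw [one_div_pow]
  exact dist_le_of_le_geometric_two_of_tendsto hstep hp n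

/-- A dyadic scale comparable to the diameter `d` of a covering set. The slack `η` serves sets of
diameter zero, which have no comparable scale. -/
lemma exists_pow_near {d η : ℝ≥0∞} {s : ℝ} (hs : 0 < s) (hη : η ≠ 0) {N : ℕ}
    (hd : d ≤ 2⁻¹ ^ N) :
    ∃ k ≥ N, d ≤ 2⁻¹ ^ k ∧ ((2⁻¹ : ℝ≥0∞) ^ s) ^ k ≤ 2 ^ s * d ^ s + η := by
  have hhalf : (2⁻¹ : ℝ≥0∞) < 1 := by simp
  have hb : (2⁻¹ : ℝ≥0∞) ^ s < 1 := ENNReal.rpow_lt_one hhalf hs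
  by_cases h0 : d = 0
  · obtain ⟨k, hk, hkN⟩ := (((ENNReal.tendsto_pow_atTop_nhds_zero_of_lt_one hb).eventually_lt_const
      (pos_iff_ne_zero.2 hη)).and (eventually_ge_atTop N)).exists
    exact ⟨k, hkN, by simp [h0], hk.le.trans le_add_self⟩
  · have hex : ∃ k, (2⁻¹ : ℝ≥0∞) ^ k < d :=
      ((ENNReal.tendsto_pow_atTop_nhds_zero_of_lt_one hhalf).eventually_lt_const
        (pos_iff_ne_zero.2 h0)).exists
    classical
    have hfind := Nat.find_spec hex
    have hN : N < Nat.find hex := by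
      by_contra! hle
      exact absurd (hfind.trans_le hd) (not_lt.2 (pow_le_pow_right_of_le_one' hhalf.le hle))
    obtain ⟨k, hk⟩ : ∃ k, Nat.find hex = k + 1 := ⟨Nat.find hex - 1, by omega⟩
    have hmin := Nat.find_min hex (m := k) (by omega)
    refine ⟨k, by omega, not_lt.1 hmin, le_trans ?_ le_self_add⟩
    rw [hk, pow_succ] at hfind
    rw [← ENNReal.mul_rpow_of_nonneg _ _ hs.le, ← ENNReal.rpow_natCast, ← ENNReal.rpow_mul,
      mul_comm s, ENNReal.rpow_mul, ENNReal.rpow_natCast]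
    gcongr
    calc (2⁻¹ : ℝ≥0∞) ^ k = 2 * (2⁻¹ ^ k * 2⁻¹) := by
          rw [mul_comm (2⁻¹ ^ k), ← mul_assoc, ENNReal.mul_inv_cancel (by simp) (by simp), one_mul]
      _ ≤ 2 * d := by gcongr

/-- A set that contains the limit points of all paths of positive masses has positive Hausdorff
measure of order `s`, if the triangles of side `ℓ` with mass above `ℓ ^ s` have finite total
mass. -/
theorem hausdorffMeasure_ne_zero_of_mass {μ : List (Fin 3) → ℝ≥0∞} (h1 : μ [] = 1)
    (hμ : ∀ w, μ w = ∑ j, μ (j :: w)) {s : ℝ} (hs : 0 < s)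
    (hfin : ∑' w, {w | ((2⁻¹ : ℝ≥0∞) ^ s) ^ w.length < μ w}.indicator μ w ≠ ∞)
    {K : Set sierpinski}
    (hK : ∀ x p, (∀ n, μ (initialWord x n) ≠ 0) →
      (∀ n, dist (vertexPt (initialWord x n) 0) p ≤ (1 / 2) ^ n) → p ∈ K) :
    Measure.hausdorffMeasure s K ≠ 0 := by
  classical
  intro hzero
  set L : Set (List (Fin 3)) := {w | ((2⁻¹ : ℝ≥0∞) ^ s) ^ w.length < μ w} with hL
  -- Finitely many heavy words are discarded so that the others have total mass below one half;
  -- scales from `N` on never meet the discarded ones.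
  obtain ⟨t₀, ht₀⟩ := ((ENNReal.tendsto_tsum_compl_atTop_zero hfin).eventually_lt_const
    (by simp : (0 : ℝ≥0∞) < 2⁻¹)).exists
  have hT : ∑' w, (L \ t₀).indicator μ w < 2⁻¹ := by
    refine lt_of_le_of_lt (le_of_eq ?_) ht₀
    change _ = ∑' w : ((t₀ : Set (List (Fin 3)))ᶜ : Set _), L.indicator μ w
    rw [tsum_subtype ((t₀ : Set (List (Fin 3)))ᶜ) (L.indicator μ), indicator_indicator,
      inter_comm]
    rfl
  obtain ⟨N, hN⟩ : ∃ N, ∀ w ∈ t₀, w.length < N :=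
    ⟨t₀.sup List.length + 1, fun w hw => Nat.lt_succ_of_le (Finset.le_sup (f := List.length) hw)⟩
  obtain ⟨ε, hε0, hε⟩ : ∃ ε : ℝ≥0∞, 0 < ε ∧ 121 * (2 ^ s * ε + ε) < 2⁻¹ := by
    have hlim : Tendsto (fun ε : ℝ≥0∞ => 121 * (2 ^ s * ε + ε)) (𝓝 0)
        (𝓝 (121 * (2 ^ s * 0 + 0))) := by
      refine ENNReal.Tendsto.const_mul (Tendsto.add (ENNReal.Tendsto.const_mul tendsto_id
        (Or.inr (by finiteness))) tendsto_id) (Or.inr (by simp))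
    simp only [mul_zero, add_zero] at hlim
    have h2 : ∀ᶠ ε in 𝓝[>] (0 : ℝ≥0∞), 121 * (2 ^ s * ε + ε) < 2⁻¹ :=
      (hlim.eventually_lt_const (by simp)).filter_mono nhdsWithin_le_nhds
    obtain ⟨ε, h, h'⟩ := (h2.and self_mem_nhdsWithin).exists
    exact ⟨ε, h', h⟩
  obtain ⟨U, hKU, hUd, hU⟩ : ∃ U : ℕ → Set sierpinski, K ⊆ ⋃ n, U n ∧
      (∀ n, Metric.ediam (U n) ≤ 2⁻¹ ^ N) ∧
      ∑' n, ⨆ _ : (U n).Nonempty, Metric.ediam (U n) ^ s < ε := by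
    rw [Measure.hausdorffMeasure_apply] at hzero
    have hz := lt_of_le_of_lt
      ((le_iSup₂ (f := fun (r : ℝ≥0∞) (_ : 0 < r) => ⨅ (t : ℕ → Set sierpinski)
        (_ : K ⊆ ⋃ n, t n) (_ : ∀ n, Metric.ediam (t n) ≤ r),
          ∑' n, ⨆ _ : (t n).Nonempty, Metric.ediam (t n) ^ s) (2⁻¹ ^ N)
        (ENNReal.pow_pos (by simp) N)).trans hzero.le) hε0
    simpa only [iInf_lt_iff, exists_prop] using hz
  obtain ⟨η, hη0, hη⟩ := ENNReal.exists_pos_sum_of_countable hε0.ne' ℕ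
  choose k hkN hkd hks using fun n =>
    exists_pow_near hs (ENNReal.coe_ne_zero.2 (hη0 n).ne') (hUd n)
  set V : ℕ → Finset (List (Fin 3)) := fun n =>
    (words (k n)).filter fun w => ∃ y ∈ U n, dist (vertexPt w 0) y ≤ (1 / 2) ^ k n with hV
  -- The light triangles near a covering set, each at the scale chosen for that set; a cover of
  -- small `s`-sum makes their total mass less than one half too.
  set C : Set (List (Fin 3)) := {w | w ∉ L ∧ ∃ n, w ∈ V n} with hC
  have hsum : ∑' w, C.indicator μ w < 2⁻¹ := by
    refine lt_of_le_of_lt ?_ hε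
    calc ∑' w, C.indicator μ w
        ≤ ∑' w, ∑' n, (V n : Set (List (Fin 3))).indicator
            (fun _ => ((2⁻¹ : ℝ≥0∞) ^ s) ^ k n) w := by
          refine ENNReal.tsum_le_tsum fun w => ?_
          by_cases hw : w ∈ C
          · obtain ⟨hwL, n, hn⟩ := hw
            refine le_trans ?_ (ENNReal.le_tsum n)
            rw [indicator_of_mem (show w ∈ C from ⟨hwL, n, hn⟩),
              indicator_of_mem (Finset.mem_coe.2 hn)]
            have hlen : w.length = k n := mem_words.1 (Finset.mem_filter.1 hn).1
            rw [← hlen]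
            exact not_lt.1 hwL
          · rw [indicator_of_notMem hw]
            exact zero_le
      _ = ∑' n, (V n).card * ((2⁻¹ : ℝ≥0∞) ^ s) ^ k n := by
          rw [ENNReal.tsum_comm]
          refine tsum_congr fun n => ?_
          rw [tsum_eq_sum (s := V n) (fun w hw => indicator_of_notMem (by simpa using hw) _),
            Finset.sum_congr rfl (fun w hw => indicator_of_mem (Finset.mem_coe.2 hw) _),
            Finset.sum_const, nsmul_eq_mul]
      _ ≤ ∑' n, 121 * (2 ^ s * (⨆ _ : (U n).Nonempty, Metric.ediam (U n) ^ s) + η n) := by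
          refine ENNReal.tsum_le_tsum fun n => ?_
          rcases (U n).eq_empty_or_nonempty with he | hne
          · simp [hV, he]
          · rw [iSup_pos hne]
            gcongr
            · exact_mod_cast card_words_near_le (k n) (U n) (hkd n)
            · exact hks n
      _ ≤ 121 * (2 ^ s * ε + ε) := by
          rw [ENNReal.tsum_mul_left, ENNReal.tsum_add, ENNReal.tsum_mul_left]
          gcongr
  -- A path avoiding both kinds of words ends at a point of `K` in some `U n`, yet its word of
  -- length `k n` is of one of these kinds.
  obtain ⟨x, hx⟩ := exists_path_avoiding hμ (S := (L \ t₀) ∪ C) (by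
    calc ∑' w, ((L \ t₀) ∪ C).indicator μ w
        ≤ ∑' w, ((L \ t₀).indicator μ w + C.indicator μ w) := by
          refine ENNReal.tsum_le_tsum fun w => ?_
          rw [← indicator_union_add_inter_apply]
          exact le_self_add
      _ = ∑' w, (L \ t₀).indicator μ w + ∑' w, C.indicator μ w := ENNReal.tsum_add
      _ < 2⁻¹ + 2⁻¹ := ENNReal.add_lt_add hT hsum
      _ = μ [] := by rw [h1, ENNReal.inv_two_add_inv_two])
  obtain ⟨p, hp⟩ := exists_limit_point x
  obtain ⟨n, hn⟩ := mem_iUnion.1 (hKU (hK x p (fun n => (hx n).2) hp))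
  have hw : initialWord x (k n) ∈ V n := by
    simp only [hV, Finset.mem_filter, mem_words]
    exact ⟨length_initialWord x _, p, hn, hp _⟩
  refine (hx (k n)).1 ?_
  by_cases hwL : initialWord x (k n) ∈ L
  · refine Or.inl ⟨hwL, fun ht => ?_⟩
    have := hN _ ht
    rw [length_initialWord] at this
    exact absurd (hkN n) (by omega)
  · exact Or.inr ⟨hwL, n, hw⟩
/-! ### The function `h` -/

lemma continuous_h_numerator : Continuous fun d : ℝ =>
    -d * Real.log d - (1 - d) * Real.log (1 - d) + d * Real.log 6 := by
  have h1 : Continuous fun d : ℝ => (1 - d) * Real.log (1 - d) :=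
    Real.continuous_mul_log.comp (continuous_const.sub continuous_id)
  simp only [neg_mul]
  exact (Real.continuous_mul_log.neg.sub h1).add (continuous_id.mul continuous_const)

lemma continuousOn_h : ContinuousOn h (Icc 0 (1 / 2)) := by
  refine continuous_h_numerator.continuousOn.div (by fun_prop) fun d hd => ?_
  have := Real.log_pos one_lt_two
  have := hd.1
  positivity

lemma hasDerivAt_h {d : ℝ} (h0 : 0 < d) (h1 : d < 1) :
    HasDerivAt h ((-Real.log d + 2 * Real.log (1 - d) + Real.log 6) /
      ((1 + d) ^ 2 * Real.log 2)) d := by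
  have h1' : (0 : ℝ) < 1 - d := by linarith
  have hl := Real.log_pos one_lt_two
  have e1 : HasDerivAt (fun d : ℝ => d * Real.log d) (Real.log d + 1) d :=
    Real.hasDerivAt_mul_log h0.ne'
  have e2 : HasDerivAt (fun d : ℝ => (1 - d) * Real.log (1 - d))
      ((Real.log (1 - d) + 1) * (-1)) d :=
    (Real.hasDerivAt_mul_log h1'.ne').comp d ((hasDerivAt_id d).const_sub 1)
  have e3 : HasDerivAt (fun d : ℝ => d * Real.log 6) (1 * Real.log 6) d :=
    (hasDerivAt_id d).mul_const _
  have e4 : HasDerivAt (fun d : ℝ => (1 + d) * Real.log 2) (1 * Real.log 2) d :=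
    ((hasDerivAt_id d).const_add 1).mul_const _
  have e := ((e1.neg.sub e2).add e3).div e4 (by positivity)
  refine (e.congr_deriv ?_).congr_of_eventuallyEq (Eventually.of_forall fun x => ?_)
  · simp only [Pi.add_apply, Pi.sub_apply, Pi.neg_apply]
    field_simp
    ring
  · simp only [h, Pi.div_apply, Pi.add_apply, Pi.sub_apply, Pi.neg_apply, neg_mul]

/-- The derivative has the sign of `log (6 * (1 - d) ^ 2 / d)`, positive for `0 < d < 1 / 2`. -/
lemma strictMonoOn_h : StrictMonoOn h (Icc 0 (1 / 2)) := by
  refine strictMonoOn_of_deriv_pos (convex_Icc _ _) continuousOn_h fun d hd => ?_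
  rw [interior_Icc] at hd
  obtain ⟨h0, h1⟩ := hd
  have h1' : (0 : ℝ) < 1 - d := by linarith
  rw [(hasDerivAt_h h0 (by linarith)).deriv]
  have hl := Real.log_pos one_lt_two
  refine div_pos ?_ (by positivity)
  have hlog : Real.log d < Real.log (6 * (1 - d) ^ 2) := Real.log_lt_log h0 (by nlinarith)
  rw [Real.log_mul (by norm_num) (by positivity), Real.log_pow] at hlog
  push_cast at hlog
  linarith

lemma h_zero : h 0 = 0 := by simp [h]

lemma one_le_h_half : 1 ≤ h (1 / 2) := by
  have hl := Real.log_pos one_lt_two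
  have h6 : Real.log 2 ≤ Real.log 6 := Real.log_le_log (by norm_num) (by norm_num)
  have hhalf : Real.log (1 / 2) = -Real.log 2 := by rw [one_div, Real.log_inv]
  rw [h, le_div_iff₀ (by positivity), show (1 : ℝ) - 1 / 2 = 1 / 2 by norm_num, hhalf]
  linarith

lemma mem_image_h {α : ℝ} (hα0 : 0 < α) (hα1 : α ≤ 1) : α ∈ h '' Ioc 0 (1 / 2) := by
  obtain ⟨d, hd, rfl⟩ := intermediate_value_Icc (by norm_num : (0 : ℝ) ≤ 1 / 2) continuousOn_h
    ⟨h_zero.trans_le hα0.le, hα1.trans one_le_h_half⟩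
  refine ⟨d, ⟨lt_of_le_of_ne hd.1 ?_, hd.2⟩, rfl⟩
  rintro rfl
  exact hα0.ne' h_zero

lemma exists_exponent {α d δ : ℝ} (hα1 : α ≤ 1) (hd0 : 0 < d) (hd1 : d ≤ 1 / 2) (hd : h d = α)
    (hδ : δ < d) :
    ∃ q : ℝ, 0 < q ∧ (1 + 6 * (1 / 2 : ℝ) ^ (1 + q)) * (1 / 2 : ℝ) ^ α *
      (((1 / 2 : ℝ) ^ δ)⁻¹) ^ q < 1 := by
  have hl := Real.log_pos one_lt_two
  have hd1' : (0 : ℝ) < 1 - d := by linarith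
  -- With `y = 2 ^ (-q)`, this value minimizes `(1 + 3 * y) * y ^ (-d)`.
  set y : ℝ := d / (3 * (1 - d)) with hy
  have hy0 : 0 < y := by positivity
  have hy1 : y < 1 := by rw [hy, div_lt_one (by positivity)]; linarith
  have hly : Real.log y < 0 := Real.log_neg hy0 hy1
  have hlog : Real.log y = Real.log d - Real.log 3 - Real.log (1 - d) := by
    rw [hy, Real.log_div hd0.ne' (by positivity), Real.log_mul (by norm_num) hd1'.ne']
    ring
  refine ⟨-Real.log y / Real.log 2, div_pos (by linarith) hl, ?_⟩
  set q : ℝ := -Real.log y / Real.log 2 with hq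
  have hq2 : q * Real.log 2 = -Real.log y := by rw [hq]; field_simp
  have hhalf : Real.log (1 / 2) = -Real.log 2 := by rw [one_div, Real.log_inv]
  have e1 : (1 / 2 : ℝ) ^ q = y := by
    rw [Real.rpow_def_of_pos (by norm_num), hhalf,
      show -Real.log 2 * q = Real.log y by linarith, Real.exp_log hy0]
  have e2 : 1 + 6 * (1 / 2 : ℝ) ^ (1 + q) = (1 - d)⁻¹ := by
    rw [Real.rpow_add (by norm_num), e1, Real.rpow_one, hy]
    field_simp
    ring
  have e3 : (((1 / 2 : ℝ) ^ δ)⁻¹) ^ q = Real.exp (-δ * Real.log y) := by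
    rw [Real.inv_rpow (by positivity), ← Real.rpow_mul (by norm_num), mul_comm δ,
      Real.rpow_mul (by norm_num), e1, Real.rpow_def_of_pos hy0, ← Real.exp_neg]
    congr 1
    ring
  have e4 : (1 / 2 : ℝ) ^ α = Real.exp (-Real.log 2 * α) := by
    rw [Real.rpow_def_of_pos (by norm_num), hhalf]
  rw [e2, e3, e4, ← Real.exp_log (inv_pos.2 hd1'), ← Real.exp_add, ← Real.exp_add,
    Real.exp_lt_one_iff, Real.log_inv]
  have hval : -d * Real.log d - (1 - d) * Real.log (1 - d) + d * (Real.log 2 + Real.log 3) =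
      α * ((1 + d) * Real.log 2) := by
    rw [← Real.log_mul (by norm_num) (by norm_num), show (2 : ℝ) * 3 = 6 by norm_num, ← hd, h,
      div_mul_cancel₀ _ (by positivity)]
  -- With `d` in place of `δ` the exponent equals `d * (α - 1) * log 2`, which is at most zero; `δ <
  -- d` makes it negative.
  have h2 : -δ * Real.log y < -d * Real.log y := by nlinarith
  have h3 : d * (α - 1) * Real.log 2 ≤ 0 :=
    mul_nonpos_of_nonpos_of_nonneg (mul_nonpos_of_nonneg_of_nonpos hd0.le (by linarith)) hl.le
  have h4 : -d * Real.log y = -d * (Real.log d - Real.log 3 - Real.log (1 - d)) := by rw [hlog]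
  nlinarith

lemma exists_exponent_ennreal {α d δ : ℝ} (hα1 : α ≤ 1) (hd0 : 0 < d) (hd1 : d ≤ 1 / 2)
    (hd : h d = α) (hδ : δ < d) :
    ∃ q : ℝ, 0 < q ∧ (1 + 6 * (2⁻¹ : ℝ≥0∞) ^ (1 + q)) * ENNReal.ofReal ((1 / 2 : ℝ) ^ α) *
      (((2⁻¹ : ℝ≥0∞) ^ δ)⁻¹) ^ q < 1 := by
  obtain ⟨q, hq, hlt⟩ := exists_exponent hα1 hd0 hd1 hd hδ
  refine ⟨q, hq, ?_⟩
  have h2 : (2⁻¹ : ℝ≥0∞) = ENNReal.ofReal (1 / 2) := by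
    rw [one_div, ENNReal.ofReal_inv_of_pos two_pos]; simp
  have h6 : (6 : ℝ≥0∞) = ENNReal.ofReal 6 := by simp
  rw [h2, h6, ENNReal.ofReal_rpow_of_pos (by norm_num), ENNReal.ofReal_rpow_of_pos (by norm_num),
    ← ENNReal.ofReal_inv_of_pos (by positivity), ENNReal.ofReal_rpow_of_pos (by positivity),
    ← ENNReal.ofReal_one, ← ENNReal.ofReal_mul (by norm_num),
    ← ENNReal.ofReal_add (by norm_num) (by positivity), ← ENNReal.ofReal_mul (by positivity),
    ← ENNReal.ofReal_mul (by positivity)]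
  exact (ENNReal.ofReal_lt_ofReal_iff one_pos).2 hlt

/-! ### Level sets of Hölder functions on the Sierpiński triangle -/

section Level

variable {α : ℝ} {f : sierpinski → ℝ}

lemma IsHolder.abs_sub_vertexPt_le (hf : IsHolder 1 α f) (hα0 : 0 < α) (w : List (Fin 3))
    (i j : Fin 3) : |f (vertexPt w i) - f (vertexPt w j)| ≤ ((1 / 2 : ℝ) ^ α) ^ w.length := by
  refine (hf _ _).trans ?_
  rw [one_mul, ← Real.rpow_natCast, ← Real.rpow_mul (by norm_num), mul_comm,
    Real.rpow_mul (by norm_num), Real.rpow_natCast]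
  exact Real.rpow_le_rpow dist_nonneg (dist_vertexPt_le w i j) hα0.le

lemma IsHolder.continuous (hf : IsHolder 1 α f) (hα0 : 0 < α) : Continuous f := by
  refine continuous_iff_continuousAt.2 fun b => tendsto_iff_dist_tendsto_zero.2 ?_
  have hlim : Tendsto (fun a => dist a b ^ α) (𝓝 b) (𝓝 0) := by
    have := ((continuous_id.dist continuous_const).rpow_const
      fun _ => Or.inr hα0.le : Continuous fun a : sierpinski => dist a b ^ α).tendsto b
    simpa [Real.zero_rpow hα0.ne'] using this
  exact squeeze_zero (fun _ => dist_nonneg) (fun a => by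
    simpa [Real.dist_eq] using hf a b) hlim

/-- A function takes the value `r` at the limit point of triangles cut by `r`. -/
lemma eq_of_isCut_of_tendsto (hf : Continuous f) {r : ℝ} {W : ℕ → List (Fin 3)}
    (hlen : ∀ n, (W n).length = n) (hW : ∀ n, IsCut (fun i => f (vertexPt (W n) i)) r)
    {p : sierpinski} (hp : ∀ n, dist (vertexPt (W n) 0) p ≤ (1 / 2) ^ n) : f p = r := by
  have hlim : ∀ i : ℕ → Fin 3, Tendsto (fun n => f (vertexPt (W n) (i n))) atTop (𝓝 (f p)) := by
    refine fun i => (hf.tendsto p).comp (tendsto_iff_dist_tendsto_zero.2 ?_)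
    have h0 : Tendsto (fun n : ℕ => (1 / 2 : ℝ) ^ n + (1 / 2 : ℝ) ^ n) atTop (𝓝 0) := by
      have := tendsto_pow_atTop_nhds_zero_of_lt_one (by norm_num : (0 : ℝ) ≤ 1 / 2) (by norm_num)
      simpa using this.add this
    refine squeeze_zero (fun _ => dist_nonneg) (fun n => ?_) h0
    refine (dist_triangle _ (vertexPt (W n) 0) _).trans (add_le_add ?_ (hp n))
    simpa only [hlen n] using dist_vertexPt_le (W n) (i n) 0
  choose i j hi hj using hW
  exact le_antisymm (le_of_tendsto' (hlim i) fun n => (hi n).le)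
    (ge_of_tendsto' (hlim j) fun n => (hj n).le)

lemma IsHolder.ae_le_dimH_of_isCut_root (hf : IsHolder 1 α f) (hα0 : 0 < α) (hα1 : α ≤ 1)
    {d δ : ℝ} (hd0 : 0 < d) (hd1 : d ≤ 1 / 2) (hd : h d = α) (hδ0 : 0 < δ) (hδ : δ < d) :
    ∀ᵐ r ∂(volume : Measure ℝ), IsCut (fun i => f (vertexPt [] i)) r →
      ENNReal.ofReal δ ≤ dimH (f ⁻¹' {r}) := by
  have hg := isVertexTree_vertexPt f
  obtain ⟨q, hq, hlt⟩ := exists_exponent_ennreal hα1 hd0 hd1 hd hδ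
  filter_upwards [hg.ae_tsum_large_mass_ne_top (by positivity)
    (hf.abs_sub_vertexPt_le hα0) (ENNReal.rpow_pos (by simp) (by simp)).ne' (by finiteness) hq hlt,
    ae_forall_ne fun w i => f (vertexPt w i)] with r hr hne h0
  have hpos := hausdorffMeasure_ne_zero_of_mass (K := f ⁻¹' {r}) rfl (hg.mass_eq_sum hne h0) hδ0
    (hr h0) fun x p hx hp => eq_of_isCut_of_tendsto (hf.continuous hα0) (length_initialWord x)
      (fun n => isCut_of_mass_ne_zero h0 (hx n)) hp
  refine le_dimH_of_hausdorffMeasure_ne_zero (d := δ.toNNReal) ?_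
  rwa [Real.coe_toNNReal _ hδ0.le]

lemma IsHolder.comp_contraction (hf : IsHolder 1 α f) (hα0 : 0 < α) (i : Fin 3) :
    IsHolder 1 α fun x => f (contraction i x) := by
  intro a b
  refine (hf _ _).trans ?_
  rw [dist_contraction]
  have : (1 / 2 * dist a b) ^ α ≤ dist a b ^ α :=
    Real.rpow_le_rpow (by positivity) (by linarith [dist_nonneg (x := a) (y := b)]) hα0.le
  linarith

lemma dimH_comp_contraction_le (f : sierpinski → ℝ) (i : Fin 3) (r : ℝ) :
    dimH ((fun x => f (contraction i x)) ⁻¹' {r}) ≤ dimH (f ⁻¹' {r}) := by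
  have hanti : AntilipschitzWith 2 (contraction i) :=
    AntilipschitzWith.of_le_mul_dist fun x y => by
      rw [dist_contraction]
      push_cast
      linarith
  exact hanti.dimH_preimage_le (f ⁻¹' {r})

/-- Composing with contractions turns the triangle `w` into the root and preserves the Hölder class;
contractions being antilipschitz, the dimension cannot increase. -/
lemma IsHolder.ae_le_dimH_of_isCut (hf : IsHolder 1 α f) (hα0 : 0 < α) (hα1 : α ≤ 1)
    {d δ : ℝ} (hd0 : 0 < d) (hd1 : d ≤ 1 / 2) (hd : h d = α) (hδ0 : 0 < δ) (hδ : δ < d)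
    (w : List (Fin 3)) :
    ∀ᵐ r ∂(volume : Measure ℝ), IsCut (fun i => f (vertexPt w i)) r →
      ENNReal.ofReal δ ≤ dimH (f ⁻¹' {r}) := by
  induction w using List.reverseRecOn generalizing f with
  | nil => exact hf.ae_le_dimH_of_isCut_root hα0 hα1 hd0 hd1 hd hδ0 hδ
  | append_singleton w i ih =>
    filter_upwards [ih (hf.comp_contraction hα0 i)] with r hr hcut
    refine (hr ?_).trans (dimH_comp_contraction_le f i r)
    simpa only [contraction_vertexPt] using hcut

/-- Levels between two values of a continuous function cut some triangle. -/
lemma exists_isCut (hf : Continuous f) {r : ℝ} (hr : ∀ w i, f (vertexPt w i) ≠ r)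
    {a b : sierpinski} (ha : f a < r) (hb : r < f b) :
    ∃ w, IsCut (fun i => f (vertexPt w i)) r := by
  by_contra! hc
  have hside : ∀ w i j, f (vertexPt w i) < r → f (vertexPt w j) < r := fun w i j hi =>
    lt_of_le_of_ne (not_lt.1 fun hj => hc w ⟨i, j, hi, hj⟩) (hr w j)
  -- An uncut triangle lies on one side of `r`, and a child shares a vertex with its parent; so all
  -- vertices lie on the side of the root, contrary to their density.
  have hroot : ∀ w i, f (vertexPt w i) < r ↔ f (vertexPt [] 0) < r := by
    intro w
    induction w with
    | nil => exact fun i => ⟨hside _ _ _, hside _ _ _⟩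
    | cons k w ih =>
      intro i
      rw [← ih k, ← (isVertexTree_vertexPt f).self w k]
      exact ⟨hside _ _ _, hside _ _ _⟩
  obtain ⟨ε, hε, hεa⟩ := Metric.eventually_nhds_iff.1 ((hf.tendsto a).eventually_lt_const ha)
  obtain ⟨η, hη, hηb⟩ := Metric.eventually_nhds_iff.1 ((hf.tendsto b).eventually_const_lt hb)
  obtain ⟨u, hu⟩ := exists_vertexPt_near a hε
  obtain ⟨v, hv⟩ := exists_vertexPt_near b hη
  exact lt_asymm (hηb hv) ((hroot v 0).2 ((hroot u 0).1 (hεa hu)))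

/-- Almost every level strictly between the infimum and the supremum of a Hölder function has a
level set of dimension at least `d`, where `h d = α`. -/
theorem IsHolder.ae_le_dimH (hf : IsHolder 1 α f) (hα0 : 0 < α) (hα1 : α ≤ 1)
    {d : ℝ} (hd0 : 0 < d) (hd1 : d ≤ 1 / 2) (hd : h d = α) :
    ∀ᵐ r ∂(volume : Measure ℝ), (∃ a, f a < r) → (∃ b, r < f b) →
      ENNReal.ofReal d ≤ dimH (f ⁻¹' {r}) := by
  obtain ⟨u, -, hu, hlim⟩ := exists_seq_strictMono_tendsto' hd0
  filter_upwards [ae_forall_ne fun w i => f (vertexPt w i), ae_all_iff.2 fun n : ℕ =>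
    ae_all_iff.2 (hf.ae_le_dimH_of_isCut hα0 hα1 hd0 hd1 hd (hu n).1 (hu n).2)] with r hne hr
  rintro ⟨a, ha⟩ ⟨b, hb⟩
  obtain ⟨w, hw⟩ := exists_isCut (hf.continuous hα0) hne ha hb
  exact le_of_tendsto' (ENNReal.tendsto_ofReal hlim) fun n => hr n w hw

lemma IsHolder.ae_range_le_dimH (hf : IsHolder 1 α f) (hα0 : 0 < α) (hα1 : α ≤ 1)
    {d : ℝ} (hd0 : 0 < d) (hd1 : d ≤ 1 / 2) (hd : h d = α) :
    ∀ᵐ r ∂(volume : Measure ℝ), r ∈ range f → ENNReal.ofReal d ≤ dimH (f ⁻¹' {r}) := by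
  -- The extreme values, the only ones in the range not strictly between two others, form a null
  -- set.
  have hleast : {r | IsLeast (range f) r}.Subsingleton := fun _ h _ h' => h.unique h'
  have hgreatest : {r | IsGreatest (range f) r}.Subsingleton := fun _ h _ h' => h.unique h'
  filter_upwards [hf.ae_le_dimH hα0 hα1 hd0 hd1 hd, hleast.countable.ae_notMem volume,
    hgreatest.countable.ae_notMem volume] with r hr hl hg hmem
  refine hr ?_ ?_
  · by_contra! hc
    exact hl ⟨hmem, forall_mem_range.2 hc⟩
  · by_contra! hc
    exact hg ⟨hmem, forall_mem_range.2 hc⟩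

lemma IsHolder.le_DStarFun (hf : IsHolder 1 α f) (hα0 : 0 < α) (hα1 : α ≤ 1)
    {d : ℝ} (hd0 : 0 < d) (hd1 : d ≤ 1 / 2) (hd : h d = α) {a b : sierpinski} (hab : f a < f b) :
    ENNReal.ofReal d ≤ DStarFun f := by
  refine le_sSup (lt_of_lt_of_le (b := volume (Ioo (f a) (f b))) (by simpa using hab) ?_)
  refine measure_mono_ae ?_
  filter_upwards [hf.ae_le_dimH hα0 hα1 hd0 hd1 hd] with r hr hmem
  exact hr ⟨a, hmem.1⟩ ⟨b, hmem.2⟩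

end Level

/-! ### Generic functions are not constant -/

lemma dist_le_one (x y : sierpinski) : dist x y ≤ 1 := by
  have : convexHull ℝ (range corner) ⊆ Metric.closedBall (y : EuclideanSpace ℝ (Fin 2)) 1 :=
    convexHull_min (range_subset_iff.2 fun j => by
      rw [Metric.mem_closedBall, dist_comm]
      exact dist_corner_le_of_mem (mem_iInter.1 y.2 0) j) (convex_closedBall _ _)
  exact this (mem_iInter.1 x.2 0)

lemma isOpen_nonconstant (α : ℝ) :
    IsOpen {f : holderSpace 1 α sierpinski | ∃ a b, (f : C(sierpinski, ℝ)) a < f.1 b} := by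
  simp only [ofPred_exists]
  refine isOpen_iUnion fun a => isOpen_iUnion fun b => isOpen_lt ?_ ?_
  · exact (continuous_eval_const a).comp continuous_subtype_val
  · exact (continuous_eval_const b).comp continuous_subtype_val

/-- A constant is perturbed by a small multiple of the distance to a vertex, which is 1-Hölder-`α`
since the diameter and `α` are at most one. -/
lemma dense_nonconstant {α : ℝ} (hα1 : α ≤ 1) :
    Dense {f : holderSpace 1 α sierpinski | ∃ a b, (f : C(sierpinski, ℝ)) a < f.1 b} := by
  refine Metric.dense_iff.2 fun f ρ hρ => ?_
  by_cases hf : ∃ a b, (f : C(sierpinski, ℝ)) a < f.1 b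
  · exact ⟨f, Metric.mem_ball_self hρ, hf⟩
  push Not at hf
  set p := vertexPt [] 0
  set ε : ℝ := min 1 (ρ / 2) with hε
  have hε0 : 0 < ε := lt_min one_pos (by linarith)
  have hε1 : ε ≤ 1 := min_le_left _ _
  let g : C(sierpinski, ℝ) := ⟨fun x => f.1 x + ε * dist x p, by fun_prop⟩
  have hg : g ∈ holderSpace 1 α sierpinski := by
    intro a b
    have hc : f.1 a = f.1 b := le_antisymm (hf b a) (hf a b)
    have h1 : g a - g b = ε * (dist a p - dist b p) := by
      simp only [g, ContinuousMap.coe_mk, hc]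
      ring
    rw [h1, abs_mul, abs_of_pos hε0]
    refine mul_le_mul hε1 ((abs_dist_sub_le a b p).trans ?_) (abs_nonneg _) zero_le_one
    rcases (dist_nonneg (x := a) (y := b)).eq_or_lt with h0 | h0
    · rw [← h0]
      exact Real.rpow_nonneg le_rfl _
    · simpa using Real.rpow_le_rpow_of_exponent_ge h0 (dist_le_one a b) hα1
  refine ⟨⟨g, hg⟩, ?_, p, vertexPt [] 1, ?_⟩
  · rw [Metric.mem_ball, Subtype.dist_eq]
    refine lt_of_le_of_lt ((ContinuousMap.dist_le hε0.le).2 fun x => ?_)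
      (lt_of_le_of_lt (min_le_right _ _ : ε ≤ ρ / 2) (by linarith))
    simp only [g, ContinuousMap.coe_mk, Real.dist_eq, add_sub_cancel_left]
    rw [abs_of_nonneg (by positivity)]
    exact mul_le_of_le_one_right hε0.le (dist_le_one x p)
  · have hne : vertexPt [] 1 ≠ p := by
      intro he
      have := congrArg (fun x : EuclideanSpace ℝ (Fin 2) => x 0) (congrArg Subtype.val he)
      simp [p, vertexPt, vertex, corner] at this
    have hpos : 0 < ε * dist (vertexPt [] 1) p := mul_pos hε0 (dist_pos.2 hne)
    have hc := hf (vertexPt [] 1) p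
    simp only [g, ContinuousMap.coe_mk, dist_self, mul_zero, add_zero]
    linarith

lemma le_DStar_sierpinski {α : ℝ} (hα0 : 0 < α) (hα1 : α ≤ 1)
    {d : ℝ} (hd0 : 0 < d) (hd1 : d ≤ 1 / 2) (hd : h d = α) :
    ENNReal.ofReal d ≤ DStar α sierpinski := by
  refine le_trans ?_ (le_iSup₂_of_le _ (dense_nonconstant hα1)
    (le_iSup_of_le (isOpen_nonconstant α).isGδ le_rfl))
  refine le_iInf₂ fun f hf => ?_
  obtain ⟨a, b, hab⟩ := hf
  exact IsHolder.le_DStarFun f.2 hα0 hα1 hd0 hd1 hd hab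

end HolderLevelSets

open HolderLevelSets in
/-- The first two conjuncts say that `hInv α` is the value at `α` of a genuine inverse function. -/
theorem theorem3p4 (α : ℝ) (hα0 : 0 < α) (hα1 : α ≤ 1) :
    Set.InjOn h (Set.Ioc 0 (1 / 2)) ∧
    α ∈ h '' Set.Ioc 0 (1 / 2) ∧
    (∀ f : sierpinski → ℝ, IsHolder 1 α f →
      ∀ᵐ r ∂(MeasureTheory.volume : MeasureTheory.Measure ℝ), r ∈ Set.range f →
        ENNReal.ofReal (hInv α / (1 + hInv α)) ≤ dimH (f ⁻¹' {r})) ∧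
    ENNReal.ofReal (hInv α) ≤ DStar α sierpinski := by
  have himage := mem_image_h hα0 hα1
  obtain ⟨hd0, hd1⟩ : hInv α ∈ Set.Ioc 0 (1 / 2) := Function.invFunOn_mem himage
  have hd : h (hInv α) = α := Function.invFunOn_eq himage
  refine ⟨strictMonoOn_h.injOn.mono Set.Ioc_subset_Icc_self, himage, fun f hf => ?_,
    le_DStar_sierpinski hα0 hα1 hd0 hd1 hd⟩
  filter_upwards [hf.ae_range_le_dimH hα0 hα1 hd0 hd1 hd] with r hr hmem
  -- The bound `hInv α` is already proved, and dividing by `1 + hInv α` only weakens it.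
  exact (ENNReal.ofReal_le_ofReal (div_le_self hd0.le (by linarith))).trans (hr hmem)
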